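/- Let $\mathscr A,\mathscr B,\mathscr C$ be abelian categories with enough projectives, and let $(\mathscr A,\mathscr B,\mathscr C)$ be a recollement, that is, let there be functors $\mathsf i\colon\mathscr A\to\mathscr B$, $\mathsf q,\mathsf p\colon\mathscr B\to\mathscr A$, $\mathsf e\colon\mathscr B\to\mathscr C$, $\mathsf l,\mathsf r\colon\mathscr C\to\mathscr B$ such that $(\mathsf l,\mathsf e)$, $(\mathsf e,\mathsf r)$, $(\mathsf q,\mathsf i)$ and $(\mathsf i,\mathsf p)$ are adjoint pairs, $\mathsf i$, $\mathsf l$ and $\mathsf r$ are fully faithful, and the essential image of $\mathsf i$ equals $\operatorname{Ker}\mathsf e=\{B\in\mathscr B\mid \mathsf e(B)=0\}$. For an abelian category $\mathscr X$ put $$\operatorname{Findim}\mathscr X=\sup\{\operatorname{pd}_{\mathscr X}X\mid X\in\mathscr X,\ \operatorname{pd}_{\mathscr X}X<\infty\}\in\{0,1,2,\dots\}\cup\{\infty\},$$ where $\operatorname{pd}$ denotes projective dimension and zero objects have projective dimension $0$, and put $$\operatorname{pgld}_{\mathscr B}\mathscr A=\sup\{\operatorname{pd}_{\mathscr B}\mathsf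 i(A)\mid A\in\mathscr A\}.$$ Assume that $\operatorname{pgld}_{\mathscr B}\mathscr A\le 1$. Then $$\max\{\operatorname{Findim}\mathscr A,\operatorname{Findim}\mathscr C\}\le\operatorname{Findim}\mathscr B\le\operatorname{Findim}\mathscr C+2 .$$ In particular, $\operatorname{Findim}\mathscr B<\infty$ if and only if $\operatorname{Findim}\mathscr C<\infty$. -/

import Mathlib

open CategoryTheory

universe v₁ v₂ v₃ u₁ u₂ u₃

/-- A recollement `(A, B, C)` of abelian categories: functors
`i : A ⥤ B`, `q p : B ⥤ A`, `e : B ⥤ C`, `l r : C ⥤ B` such that `(l, e)`, `(e, r)`, `(q, i)`,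
`(i, p)` are adjoint pairs, `i`, `l`, `r` are fully faithful, and the essential image of `i` is
the kernel of `e` (the class of objects that `e` sends to a zero object). -/
structure AbelianRecollement
    (A : Type u₁) [Category.{v₁} A] [Abelian A]
    (B : Type u₂) [Category.{v₂} B] [Abelian B]
    (C : Type u₃) [Category.{v₃} C] [Abelian C] where
  i : A ⥤ B
  q : B ⥤ A
  p : B ⥤ A
  e : B ⥤ C
  l : C ⥤ B
  r : C ⥤ B
  adjLE : l ⊣ e
  adjER : e ⊣ r
  adjQI : q ⊣ i
  adjIP : i ⊣ p
  full_i : i.Full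
  faithful_i : i.Faithful
  full_l : l.Full
  faithful_l : l.Faithful
  full_r : r.Full
  faithful_r : r.Faithful
  essImage_i_eq_kernel_e : i.essImage = e.kernel

namespace AbelianRecollement

/-- The projective dimension of an object of an abelian category, as an element of
`{0, 1, 2, …} ∪ {∞}`. A zero object, having a projective resolution of length `0`, has projective
dimension `0` (Mathlib's `projectiveDimension` takes the value `⊥` there). -/
noncomputable def pd {A : Type u₁} [Category.{v₁} A] [Abelian A] (X : A) : ℕ∞ :=
  (projectiveDimension X).unbotD 0

theorem pd_le_iff {A : Type u₁} [Category.{v₁} A] [Abelian A] (X : A) (n : ℕ) :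
    pd X ≤ n ↔ HasProjectiveDimensionLE X n := by
  rw [← projectiveDimension_le_iff, pd]
  induction projectiveDimension X with
  | bot => simp
  | coe d => rw [WithBot.unbotD_coe]; exact WithBot.coe_le_coe.symm

/-- The (big) finitistic projective dimension: the supremum of the finite projective dimensions
of objects. -/
noncomputable def Findim (A : Type u₁) [Category.{v₁} A] [Abelian A] : ℕ∞ :=
  sSup {d : ℕ∞ | d < ⊤ ∧ ∃ X : A, pd X = d}

/-- The `A`-relative projective global dimension of `B` in a recollement `(A, B, C)`:
the supremum of the projective dimensions in `B` of the objects `i(X)`, `X` in `A`. -/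
noncomputable def pgld
    {A : Type u₁} [Category.{v₁} A] [Abelian A]
    {B : Type u₂} [Category.{v₂} B] [Abelian B]
    {C : Type u₃} [Category.{v₃} C] [Abelian C]
    (R : AbelianRecollement A B C) : ℕ∞ :=
  ⨆ X : A, pd (R.i.obj X)

end AbelianRecollement

namespace AbelianRecollement

open Limits

variable {A : Type u₁} [Category.{v₁} A] [Abelian A]
  {B : Type u₂} [Category.{v₂} B] [Abelian B]
  {C : Type u₃} [Category.{v₃} C] [Abelian C]

theorem pd_le_pd_of_forall {X : A} {Y : B}
    (h : ∀ n : ℕ, HasProjectiveDimensionLE Y n → HasProjectiveDimensionLE X n) :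
    pd X ≤ pd Y := by
  generalize hd : pd Y = d
  induction d with
  | top => exact le_top
  | coe n => exact (pd_le_iff X n).2 (h n ((pd_le_iff Y n).1 hd.le))

theorem pd_le_Findim {X : A} (h : pd X < ⊤) : pd X ≤ Findim A :=
  le_sSup ⟨h, X, rfl⟩

/-! ### Exactness, vanishing and projectives in any recollement -/

variable (R : AbelianRecollement A B C)

theorem e_preservesFiniteLimits : PreservesFiniteLimits R.e :=
  have := R.adjLE.rightAdjoint_preservesLimits
  inferInstance

theorem e_preservesFiniteColimits : PreservesFiniteColimits R.e :=
  have := R.adjER.leftAdjoint_preservesColimits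
  inferInstance

theorem i_preservesFiniteLimits : PreservesFiniteLimits R.i :=
  have := R.adjQI.rightAdjoint_preservesLimits
  inferInstance

theorem i_preservesFiniteColimits : PreservesFiniteColimits R.i :=
  have := R.adjIP.leftAdjoint_preservesColimits
  inferInstance

theorem q_preservesFiniteColimits : PreservesFiniteColimits R.q :=
  have := R.adjQI.leftAdjoint_preservesColimits
  inferInstance

theorem e_map_shortExact {S : ShortComplex B} (hS : S.ShortExact) :
    haveI := R.e_preservesFiniteLimits
    (S.map R.e).ShortExact :=
  have := R.e_preservesFiniteLimits
  have := R.e_preservesFiniteColimits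
  hS.map_of_exact R.e

theorem mem_essImage_i_iff (X : B) : R.i.essImage X ↔ IsZero (R.e.obj X) := by
  rw [R.essImage_i_eq_kernel_e]; rfl

theorem isZero_e_obj_i_obj (X : A) : IsZero (R.e.obj (R.i.obj X)) :=
  (R.mem_essImage_i_iff _).1 (R.i.obj_mem_essImage X)

/-- There are no nonzero morphisms from the image of `l` to the kernel of `e`. -/
theorem eq_zero_of_isZero_e_obj {X : C} {Y : B} (hY : IsZero (R.e.obj Y))
    (f : R.l.obj X ⟶ Y) : f = 0 :=
  (R.adjLE.homEquiv X Y).injective (hY.eq_of_tgt _ _)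

theorem isZero_q_obj_l_obj (X : C) : IsZero (R.q.obj (R.l.obj X)) := by
  rw [IsZero.iff_id_eq_zero]
  apply (R.adjQI.homEquiv _ _).injective
  rw [R.eq_zero_of_isZero_e_obj (R.isZero_e_obj_i_obj _) (R.adjQI.homEquiv _ _ _)]
  exact (R.eq_zero_of_isZero_e_obj (R.isZero_e_obj_i_obj _) _).symm

theorem isIso_e_map_counit (X : B) : IsIso (R.e.map (R.adjLE.counit.app X)) := by
  have := R.full_l
  have := R.faithful_l
  have h := R.adjLE.right_triangle_components X
  exact IsIso.of_isIso_fac_left h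

theorem isZero_e_kernel_counit (X : B) :
    IsZero (R.e.obj (kernel (R.adjLE.counit.app X))) := by
  have := R.e_preservesFiniteLimits
  have := R.isIso_e_map_counit X
  exact (isZero_kernel_of_mono _).of_iso (PreservesKernel.iso R.e (R.adjLE.counit.app X))

theorem isZero_e_cokernel_counit (X : B) :
    IsZero (R.e.obj (cokernel (R.adjLE.counit.app X))) := by
  have := R.e_preservesFiniteLimits
  have := R.e_preservesFiniteColimits
  have := R.isIso_e_map_counit X
  exact (isZero_cokernel_of_epi _).of_iso (PreservesCokernel.iso R.e (R.adjLE.counit.app X))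

theorem projective_of_projective_i_obj {X : A} (h : Projective (R.i.obj X)) : Projective X :=
  have := R.full_i
  have := R.faithful_i
  R.adjIP.projective_of_map_projective X h

theorem projective_of_projective_l_obj {X : C} (h : Projective (R.l.obj X)) : Projective X :=
  have := R.full_l
  have := R.faithful_l
  R.adjLE.projective_of_map_projective X h

theorem projective_l_obj {X : C} (h : Projective X) : Projective (R.l.obj X) :=
  have := R.e_preservesFiniteColimits
  R.adjLE.map_projective X h

theorem projective_q_obj {X : B} (h : Projective X) : Projective (R.q.obj X) :=
  have := R.i_preservesFiniteColimits
  R.adjQI.map_projective X h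

/-- Since `q` is right exact and kills `l X`, it sends the cokernel to `q P`. -/
theorem projective_q_cokernel {X : C} {P : B} [hP : Projective P] (f : R.l.obj X ⟶ P) :
    Projective (R.q.obj (cokernel f)) := by
  have := R.i_preservesFiniteLimits
  have := R.q_preservesFiniteColimits
  have : R.q.PreservesZeroMorphisms := inferInstance
  have h0 : R.q.map f = 0 := (R.isZero_q_obj_l_obj X).eq_of_src _ _
  exact .of_iso ((PreservesCokernel.iso R.q f).trans
    ((cokernelIsoOfEq h0).trans cokernelZeroIsoTarget)).symm (R.projective_q_obj hP)

/-- On short exact sequences in the kernel of `e`, the functor `q` is exact. -/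
theorem q_map_shortExact {S : ShortComplex B} (hS : S.ShortExact)
    (h₁ : R.i.essImage S.X₁) (h₂ : R.i.essImage S.X₂) (h₃ : R.i.essImage S.X₃) :
    haveI := R.q_preservesFiniteColimits
    (S.map R.q).ShortExact := by
  have := R.full_i
  have := R.faithful_i
  have := R.i_preservesFiniteLimits
  have := R.q_preservesFiniteColimits
  -- The unit identifies `S` with `i q S`, and the faithful exact `i` reflects short exactness.
  have hu (X : B) (hX : R.i.essImage X) : IsIso (R.adjQI.unit.app X) :=
    R.adjQI.isIso_unit_app_of_iso hX.getIso.symm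
  apply ShortExact.reflects_shortExact_of_faithful R.i
  refine ShortComplex.shortExact_of_iso (ShortComplex.isoMk
    (@asIso _ _ _ _ _ (hu _ h₁)) (@asIso _ _ _ _ _ (hu _ h₂)) (@asIso _ _ _ _ _ (hu _ h₃))
    ?_ ?_) hS
  · exact (R.adjQI.unit.naturality S.f).symm
  · exact (R.adjQI.unit.naturality S.g).symm

/-- The third isomorphism theorem, as a short exact sequence. -/
theorem shortExact_cokernel_comp {X Y Z : B} (f : X ⟶ Y) (g : Y ⟶ Z) [Mono g] :
    (ShortComplex.mk (cokernel.map f (f ≫ g) (𝟙 _) g (by simp))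
      (cokernel.map (f ≫ g) g f (𝟙 _) (by simp))
      (by ext; simp)).ShortExact where
  exact := (kernelCokernelCompSequence_exact f g).exact 3
  mono_f := ((kernelCokernelCompSequence_exact f g).exact 2).mono_g
    ((isZero_kernel_of_mono g).eq_of_src _ _)
  epi_g := by
    have : Epi (cokernel.π (f ≫ g) ≫
      cokernel.map (f ≫ g) g f (𝟙 _) (by simp)) := by simp; infer_instance
    exact epi_of_epi (cokernel.π (f ≫ g)) _

/-! ### Projective dimension when `pgld ≤ 1` -/

variable {R}
variable (hR : R.pgld ≤ 1)
include hR

theorem pd_i_obj_le_one (X : A) : HasProjectiveDimensionLE (R.i.obj X) 1 :=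
  (pd_le_iff _ 1).1 ((le_iSup (fun X : A ↦ pd (R.i.obj X)) X).trans hR)

theorem hasProjectiveDimensionLE_one_of_isZero_e_obj {X : B} (hX : IsZero (R.e.obj X)) :
    HasProjectiveDimensionLE X 1 := by
  obtain ⟨Y, ⟨a⟩⟩ := (R.mem_essImage_i_iff X).2 hX
  have := pd_i_obj_le_one hR Y
  exact hasProjectiveDimensionLT_of_iso a 2

/-- The image is a first syzygy of the cokernel, which has dimension at most 1, so it is projective
and `l e P` maps onto it by a split epimorphism. -/
theorem isIso_factorThruImage_counit_and_projective_image (P : B) [Projective P] :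
    IsIso (Abelian.factorThruImage (R.adjLE.counit.app P)) ∧
      Projective (Abelian.image (R.adjLE.counit.app P)) := by
  let c : R.l.obj (R.e.obj P) ⟶ P := R.adjLE.counit.app P
  have hI : (ShortComplex.mk (Abelian.image.ι c) (cokernel.π c) (by simp)).ShortExact :=
    { exact := ShortComplex.exact_kernel (cokernel.π c) }
  have hp : Projective (Abelian.image c) :=
    projective_iff_hasProjectiveDimensionLT_one.2
      (hI.hasProjectiveDimensionLT_X₁ 1 (inferInstanceAs (HasProjectiveDimensionLT P 1))
        (hasProjectiveDimensionLE_one_of_isZero_e_obj hR (R.isZero_e_cokernel_counit P)))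
  refine ⟨?_, hp⟩
  let s := Projective.factorThru (𝟙 _) (Abelian.factorThruImage c)
  have hs : s ≫ Abelian.factorThruImage c = 𝟙 _ := Projective.factorThru_comp _ _
  have hk : (𝟙 _ - Abelian.factorThruImage c ≫ s) ≫ c = 0 := by
    have h1 : Abelian.factorThruImage c ≫ Abelian.image.ι c = c := Abelian.image.fac c
    have : (𝟙 _ - Abelian.factorThruImage c ≫ s) ≫ Abelian.factorThruImage c = 0 := by
      simp [hs]
    exact (congrArg (_ ≫ ·) h1.symm).trans (by rw [reassoc_of% this, zero_comp])
  -- The complementary idempotent factors through `kernel c`, which lies in `Ker e`, so it vanishes.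
  have h0 : 𝟙 _ - Abelian.factorThruImage c ≫ s = 0 := by
    rw [← kernel.lift_ι c _ hk,
      R.eq_zero_of_isZero_e_obj (R.isZero_e_kernel_counit P) (kernel.lift c _ hk), zero_comp]
  exact ⟨s, (sub_eq_zero.1 h0).symm, hs⟩

theorem projective_l_obj_e_obj (P : B) [Projective P] : Projective (R.l.obj (R.e.obj P)) := by
  obtain ⟨_, h⟩ := isIso_factorThruImage_counit_and_projective_image hR P
  exact h.of_iso (asIso (Abelian.factorThruImage (R.adjLE.counit.app P))).symm

theorem projective_e_obj (P : B) [Projective P] : Projective (R.e.obj P) :=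
  R.projective_of_projective_l_obj (projective_l_obj_e_obj hR P)

theorem hasProjectiveDimensionLE_e_obj [EnoughProjectives B] (n : ℕ) :
    ∀ X : B, HasProjectiveDimensionLE X n → HasProjectiveDimensionLE (R.e.obj X) n := by
  induction n with
  | zero =>
    intro X hX
    have := projective_iff_hasProjectiveDimensionLT_one.2 hX
    exact projective_iff_hasProjectiveDimensionLT_one.1 (projective_e_obj hR X)
  | succ n ih =>
    intro X hX
    have hS : (ShortComplex.mk _ _ (kernel.condition (Projective.π X))).ShortExact :=
      { exact := ShortComplex.exact_kernel _ }
    exact (R.e_map_shortExact hS).hasProjectiveDimensionLT_X₃_iff n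
      (projective_e_obj hR (Projective.over X)) |>.2
      (ih _ ((hS.hasProjectiveDimensionLT_X₃_iff n (Projective.projective_over X)).1 hX))

theorem hasProjectiveDimensionLE_of_e_obj [EnoughProjectives B] (n : ℕ) :
    ∀ X : B, HasProjectiveDimensionLE (R.e.obj X) n → HasProjectiveDimensionLE X (n + 2) := by
  induction n with
  | zero =>
    intro X hX
    have hl : Projective (R.l.obj (R.e.obj X)) :=
      R.projective_l_obj (projective_iff_hasProjectiveDimensionLT_one.2 hX)
    let c : R.l.obj (R.e.obj X) ⟶ X := R.adjLE.counit.app X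
    have hc : Abelian.factorThruImage c ≫ Abelian.image.ι c = c := Abelian.image.fac c
    have h0 : kernel.ι c ≫ Abelian.factorThruImage c = 0 := by
      rw [← cancel_mono (Abelian.image.ι c), Category.assoc, hc, kernel.condition, zero_comp]
    have hK : (ShortComplex.mk (kernel.ι c) (Abelian.factorThruImage c) h0).ShortExact :=
      { exact := ShortComplex.exact_of_f_is_kernel _ <| KernelFork.IsLimit.ofι' _ _
          fun k hk ↦ ⟨kernel.lift c k (by
            have hk' : k ≫ Abelian.factorThruImage c = 0 := hk
            exact (congrArg (k ≫ ·) hc.symm).trans (by rw [reassoc_of% hk', zero_comp])),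
            kernel.lift_ι _ _ _⟩ }
    have hI : (ShortComplex.mk (Abelian.image.ι c) (cokernel.π c) (by simp)).ShortExact :=
      { exact := ShortComplex.exact_kernel (cokernel.π c) }
    have h1 := hasProjectiveDimensionLE_one_of_isZero_e_obj hR (R.isZero_e_kernel_counit X)
    have h2 := hasProjectiveDimensionLE_one_of_isZero_e_obj hR (R.isZero_e_cokernel_counit X)
    -- The kernel has dimension at most 1 and `l e X` is projective, so the image has dimension at
    -- most 2; this is the source of the 2.
    exact hI.hasProjectiveDimensionLT_X₂ 3
      ((hK.hasProjectiveDimensionLT_X₃_iff 1 hl).2 h1)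
      (hasProjectiveDimensionLT_of_ge _ 2 3 (by lia))
  | succ n ih =>
    intro X hX
    have hS : (ShortComplex.mk _ _ (kernel.condition (Projective.π X))).ShortExact :=
      { exact := ShortComplex.exact_kernel _ }
    exact (hS.hasProjectiveDimensionLT_X₃_iff (n + 2) (Projective.projective_over X)).2
      (ih _ (((R.e_map_shortExact hS).hasProjectiveDimensionLT_X₃_iff n
        (projective_e_obj hR (Projective.over X))).1 hX))

/-- Under `R.pgld ≤ 1`, the category `A` has global dimension at most one. -/
theorem hasProjectiveDimensionLE_one [EnoughProjectives B] (X : A) :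
    HasProjectiveDimensionLE X 1 := by
  have := R.full_i
  have := R.faithful_i
  have := R.q_preservesFiniteColimits
  have := R.e_preservesFiniteLimits
  let p := Projective.π (R.i.obj X)
  have hS : (ShortComplex.mk _ _ (kernel.condition p)).ShortExact :=
    { exact := ShortComplex.exact_kernel _ }
  have hK : Projective (kernel p) := projective_iff_hasProjectiveDimensionLT_one.2
    ((hS.hasProjectiveDimensionLT_X₃_iff 0 (Projective.projective_over _)).1
      (pd_i_obj_le_one hR X))
  -- Both `f` and `f ≫ g` start at `l e (kernel p)`, so `q` makes their cokernels projective; they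
  -- resolve `X` in length 1.
  let f := R.adjLE.counit.app (kernel p)
  let g := kernel.ι p
  have hX := R.isZero_e_obj_i_obj X
  let a : cokernel g ≅ R.i.obj X :=
    (cokernelIsCokernel g).coconePointUniqueUpToIso hS.gIsCokernel
  have h₁ : R.i.essImage (cokernel f) :=
    (R.mem_essImage_i_iff _).2 (R.isZero_e_cokernel_counit _)
  have h₃ : R.i.essImage (cokernel g) := ⟨X, ⟨a.symm⟩⟩
  have hT := shortExact_cokernel_comp f g
  -- `Ker e` is closed under extensions.
  have h₂ : R.i.essImage (cokernel (f ≫ g)) :=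
    (R.mem_essImage_i_iff _).2 ((R.e_map_shortExact hT).exact.isZero_X₂
      (((R.mem_essImage_i_iff _).1 h₁).eq_of_src _ _)
      (((R.mem_essImage_i_iff _).1 h₃).eq_of_tgt _ _))
  have hQ := R.q_map_shortExact hT h₁ h₂ h₃
  have := (hQ.hasProjectiveDimensionLT_X₃_iff 0 (R.projective_q_cokernel (f ≫ g))).2
    (projective_iff_hasProjectiveDimensionLT_one.1 (R.projective_q_cokernel f))
  exact @hasProjectiveDimensionLT_of_iso _ _ _ _ _
    (R.q.mapIso a ≪≫ asIso (R.adjQI.counit.app X)) 2 this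

theorem pd_le_pd_i_obj [EnoughProjectives B] (X : A) : pd X ≤ pd (R.i.obj X) := by
  refine pd_le_pd_of_forall fun n hn ↦ ?_
  cases n with
  | zero =>
    exact projective_iff_hasProjectiveDimensionLT_one.1
      (R.projective_of_projective_i_obj (projective_iff_hasProjectiveDimensionLT_one.2 hn))
  | succ n =>
    have := hasProjectiveDimensionLE_one hR X
    exact hasProjectiveDimensionLT_of_ge X 2 _ (by lia)

theorem pd_e_obj_le [EnoughProjectives B] (X : B) : pd (R.e.obj X) ≤ pd X :=
  pd_le_pd_of_forall fun n hn ↦ hasProjectiveDimensionLE_e_obj hR n X hn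

theorem pd_le_pd_e_obj_add_two [EnoughProjectives B] (X : B) :
    pd X ≤ pd (R.e.obj X) + 2 := by
  generalize hd : pd (R.e.obj X) = d
  induction d with
  | top => simp
  | coe n =>
    exact_mod_cast (pd_le_iff X (n + 2)).2
      (hasProjectiveDimensionLE_of_e_obj hR n X ((pd_le_iff _ n).1 hd.le))

theorem Findim_left_le [EnoughProjectives B] : Findim A ≤ Findim B := by
  refine sSup_le ?_
  rintro _ ⟨-, X, rfl⟩
  have h : pd (R.i.obj X) ≤ 1 := (pd_le_iff _ 1).2 (pd_i_obj_le_one hR X)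
  exact (pd_le_pd_i_obj hR X).trans (pd_le_Findim (h.trans_lt (by decide)))

/-- As `e l X ≅ X`, the object `l X` has finite dimension at least `pd X`. -/
theorem Findim_right_le [EnoughProjectives B] : Findim C ≤ Findim B := by
  refine sSup_le ?_
  rintro _ ⟨hd, X, rfl⟩
  have := R.full_l
  have := R.faithful_l
  have e : pd (R.e.obj (R.l.obj X)) = pd X :=
    congrArg (WithBot.unbotD 0)
      (projectiveDimension_eq_of_iso (asIso (R.adjLE.unit.app X))).symm
  have h := pd_le_pd_e_obj_add_two hR (R.l.obj X)
  rw [e] at h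
  rw [← e]
  exact (pd_e_obj_le hR _).trans
    (pd_le_Findim (h.trans_lt (WithTop.add_lt_top.2 ⟨hd, by decide⟩)))

theorem Findim_le_add_two [EnoughProjectives B] : Findim B ≤ Findim C + 2 := by
  refine sSup_le ?_
  rintro _ ⟨hd, X, rfl⟩
  exact (pd_le_pd_e_obj_add_two hR X).trans
    (add_le_add_left (pd_le_Findim ((pd_e_obj_le hR X).trans_lt hd)) 2)

end AbelianRecollement

theorem mainTheorem5
    {A : Type u₁} [Category.{v₁} A] [Abelian A] [EnoughProjectives A]
    {B : Type u₂} [Category.{v₂} B] [Abelian B] [EnoughProjectives B]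
    {C : Type u₃} [Category.{v₃} C] [Abelian C] [EnoughProjectives C]
    (R : AbelianRecollement A B C) (hR : R.pgld ≤ 1) :
    max (AbelianRecollement.Findim A) (AbelianRecollement.Findim C)
        ≤ AbelianRecollement.Findim B ∧
      AbelianRecollement.Findim B ≤ AbelianRecollement.Findim C + 2 ∧
      (AbelianRecollement.Findim B < ⊤ ↔ AbelianRecollement.Findim C < ⊤) :=
  have hC := AbelianRecollement.Findim_right_le hR
  have hB := AbelianRecollement.Findim_le_add_two hR
  ⟨max_le (AbelianRecollement.Findim_left_le hR) hC, hB, hC.trans_lt,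
    fun h ↦ hB.trans_lt (WithTop.add_lt_top.2 ⟨h, by decide⟩)⟩
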